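/- All graphs are simple and undirected. A graph property $\mathcal P=\{\mathcal P_n\}_{n\ge 1}$ consists, for each $n$, of an isomorphism-invariant property $\mathcal P_n$ of $n$-vertex graphs. It is nontrivial if there is an $n_0$ such that for every $n>n_0$ some $n$-vertex graph has the property and some $n$-vertex graph does not. It is subgraph closed if every subgraph of a graph with the property (that is, every graph with at least one vertex that is obtained from it, up to isomorphism, by deleting edges and isolated vertices) also has the property. An algorithm accesses an input graph $G$ on a vertex set $V$ with $|V|=n$ through a black box that on query $(u,v)\in V\times V$ returns the bit telling whether $(u,v)$ is an edge; the quantum black box is the unitary $|u,v,b\rangle\mapsto|u,v,b\oplus e\rangle$, where $e=1$ if $(u,v)$ is an edge of $G$ and $e=0$ otherwise. Let $D(\mathcal P)$, $R(\mathcal P)$ and $Q(\mathcal P)$, as functions of $n$, denote the least number of queries, in the worst case over inputs (and coin tosses), with which a deterministic, a randomized and a quantum algorithm, respectively, decides whether an $n$-vertex graph has property $\mathcal P$, where randomized and quantum algorithms have to be correct with probability at least $2/3$ on every input. **Theorem.** For every nontrivial subgraph-closed graph property $\mathcal P$, as $n\to\infty$, $$Q(\mathcal P)=\Omega(n),\qquad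 R(\mathcal P)=\Theta(n^2),\qquad D(\mathcal P)=\Theta(n^2),$$ where the implied constants may depend on $\mathcal P$. -/

import Mathlib

open Filter Asymptotics
open scoped ENNReal SimpleGraph

/-- A graph property: for each `n`, an isomorphism-invariant property of graphs on the vertex set
`Fin n`.  (Graphs have `n ≥ 1` vertices; the value at `n = 0` plays no role below.) -/
structure GraphProperty where
  Holds : ∀ n : ℕ, SimpleGraph (Fin n) → Prop
  iso_invariant : ∀ (n : ℕ) (G H : SimpleGraph (Fin n)), Nonempty (G ≃g H) →
    (Holds n G ↔ Holds n H)

namespace GraphProperty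

/-- For all sufficiently large `n` some `n`-vertex graph has the property and some has not. -/
def Nontrivial (P : GraphProperty) : Prop :=
  ∃ n₀ : ℕ, ∀ n > n₀,
    (∃ G : SimpleGraph (Fin n), P.Holds n G) ∧ ∃ G : SimpleGraph (Fin n), ¬ P.Holds n G

/-- Every (nonempty) subgraph `H` of a graph `G` with the property has the property.  `H` may have
fewer vertices than `G`: `H ⊑ G` says that `H` is isomorphic to a not necessarily induced subgraph
of `G`, that is, it arises from `G` by deleting edges and isolated vertices. -/
def SubgraphClosed (P : GraphProperty) : Prop :=
  ∀ (m n : ℕ) (H : SimpleGraph (Fin m)) (G : SimpleGraph (Fin n)),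
    0 < m → H ⊑ G → P.Holds n G → P.Holds m H

end GraphProperty

open Classical in
/-- The black box of a graph: the bit returned on the pair `(u, v)`. -/
noncomputable def edgeBit {V : Type} (G : SimpleGraph V) (p : V × V) : Bool :=
  decide (G.Adj p.1 p.2)

/-! ### Classical query algorithms -/

/-- Deterministic query algorithms for a black box with query set `I`. -/
inductive DecisionTree (I : Type) : Type
  | leaf (output : Bool) : DecisionTree I
  | query (i : I) (onFalse onTrue : DecisionTree I) : DecisionTree I

namespace DecisionTree

variable {I : Type}

/-- The output on the black box `x`. -/
def eval (x : I → Bool) : DecisionTree I → Bool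
  | leaf b => b
  | query i t₀ t₁ => if x i then t₁.eval x else t₀.eval x

/-- The largest number of queries made on any computation path. -/
def depth : DecisionTree I → ℕ
  | leaf _ => 0
  | query _ t₀ t₁ => max t₀.depth t₁.depth + 1

end DecisionTree

/-- The tree `t` outputs the right answer on `G`. -/
def GraphProperty.CorrectOn (P : GraphProperty) {n : ℕ} (G : SimpleGraph (Fin n))
    (t : DecisionTree (Fin n × Fin n)) : Prop :=
  t.eval (edgeBit G) = true ↔ P.Holds n G

/-- The deterministic query complexity of deciding whether an `n`-vertex graph has `P`. -/
noncomputable def GraphProperty.detQuery (P : GraphProperty) (n : ℕ) : ℕ :=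
  sInf {k | ∃ t : DecisionTree (Fin n × Fin n),
    t.depth ≤ k ∧ ∀ G : SimpleGraph (Fin n), P.CorrectOn G t}

/-- The randomized query complexity with two-sided bounded error: a randomized algorithm making at
most `k` queries is a probability distribution on deterministic ones, and on every input it has to
be right with probability at least `2/3`. -/
noncomputable def GraphProperty.randQuery (P : GraphProperty) (n : ℕ) : ℕ :=
  sInf {k | ∃ μ : PMF (DecisionTree (Fin n × Fin n)),
    (∀ t ∈ μ.support, t.depth ≤ k) ∧
    ∀ G : SimpleGraph (Fin n), (2 / 3 : ℝ≥0∞) ≤ μ.toOuterMeasure {t | P.CorrectOn G t}}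

/-! ### Quantum query algorithms -/

/-- The permutation `(i, b, w) ↦ (i, b ⊕ x i, w)` of the computational basis. -/
def oraclePerm {I W : Type} (x : I → Bool) : Equiv.Perm (I × Bool × W) :=
  ⟨fun s => (s.1, xor s.2.1 (x s.1), s.2.2), fun s => (s.1, xor s.2.1 (x s.1), s.2.2),
    fun s => by simp, fun s => by simp⟩

/-- The unitary quantum black box `|i, b, w⟩ ↦ |i, b ⊕ x i, w⟩`, where `w` is a basis state of the
workspace. -/
noncomputable def oracle {I W : Type} [Fintype I] [Fintype W] (x : I → Bool) :
    EuclideanSpace ℂ (I × Bool × W) ≃ₗᵢ[ℂ] EuclideanSpace ℂ (I × Bool × W) :=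
  LinearIsometryEquiv.piLpCongrLeft 2 ℂ ℂ (oraclePerm x)

/-- A quantum query algorithm for black boxes with query set `I`: a finite workspace, an initial
unit vector, input-independent unitaries, `step t` being applied right after the `(t+1)`-st query,
and the set of accepting outcomes of the final measurement in the computational basis. -/
structure QuantumAlgorithm (I : Type) [Fintype I] where
  Work : Type
  [fintypeWork : Fintype Work]
  init : EuclideanSpace ℂ (I × Bool × Work)
  norm_init : ‖init‖ = 1
  step : ℕ → EuclideanSpace ℂ (I × Bool × Work) ≃ₗᵢ[ℂ] EuclideanSpace ℂ (I × Bool × Work)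
  accept : Set (I × Bool × Work)

namespace QuantumAlgorithm

attribute [instance] QuantumAlgorithm.fintypeWork

variable {I : Type} [Fintype I] (A : QuantumAlgorithm I)

/-- The state after `t` queries to the black box `x` (and the unitary that follows the last). -/
noncomputable def state (x : I → Bool) : ℕ → EuclideanSpace ℂ (I × Bool × A.Work)
  | 0 => A.init
  | t + 1 => A.step t (oracle x (state x t))

open Classical in
/-- The probability that the measurement after `T` queries accepts. -/
noncomputable def acceptProb (x : I → Bool) (T : ℕ) : ℝ :=
  ∑ s, if s ∈ A.accept then ‖A.state x T s‖ ^ 2 else 0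

end QuantumAlgorithm

/-- With `T` queries, the quantum algorithm `A` decides `P` on `n`-vertex graphs with two-sided
error at most `1/3`. -/
def GraphProperty.QuantumDecides (P : GraphProperty) (n : ℕ)
    (A : QuantumAlgorithm (Fin n × Fin n)) (T : ℕ) : Prop :=
  ∀ G : SimpleGraph (Fin n),
    (P.Holds n G → 2 / 3 ≤ A.acceptProb (edgeBit G) T) ∧
    (¬ P.Holds n G → A.acceptProb (edgeBit G) T ≤ 1 / 3)

/-- The bounded-error quantum query complexity of deciding whether an `n`-vertex graph has `P`. -/
noncomputable def GraphProperty.quantumQuery (P : GraphProperty) (n : ℕ) : ℕ :=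
  sInf {T | ∃ A : QuantumAlgorithm (Fin n × Fin n), P.QuantumDecides n A T}

/-! ### The infima above are over nonempty sets -/

theorem edgeBit_injective {V : Type} : Function.Injective (edgeBit (V := V)) := by
  intro G H h
  ext u v
  have := congrFun h (u, v)
  simpa [edgeBit] using this

/-- A tree that queries all elements of a list and then outputs `f` of the answers. -/
theorem exists_decisionTree_list {I : Type} (L : List I) (f : List Bool → Bool) :
    ∃ t : DecisionTree I, t.depth ≤ L.length ∧ ∀ x, t.eval x = f (L.map x) := by
  induction L generalizing f with
  | nil => exact ⟨.leaf (f []), by simp [DecisionTree.depth], fun x => by simp [DecisionTree.eval]⟩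
  | cons i L ih =>
    obtain ⟨t₀, h₀, e₀⟩ := ih (fun l => f (false :: l))
    obtain ⟨t₁, h₁, e₁⟩ := ih (fun l => f (true :: l))
    refine ⟨.query i t₀ t₁, by simp [DecisionTree.depth, h₀, h₁], fun x => ?_⟩
    cases hx : x i <;> simp [DecisionTree.eval, hx, e₀, e₁]

theorem GraphProperty.exists_decisionTree (P : GraphProperty) (n : ℕ) :
    ∃ t : DecisionTree (Fin n × Fin n), t.depth ≤ n ^ 2 ∧
      ∀ G : SimpleGraph (Fin n), P.CorrectOn G t := by
  classical
  obtain ⟨t, ht, e⟩ := exists_decisionTree_list (Finset.univ : Finset (Fin n × Fin n)).toList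
    (fun l => decide (∃ G : SimpleGraph (Fin n), P.Holds n G ∧
      l = (Finset.univ : Finset (Fin n × Fin n)).toList.map (edgeBit G)))
  refine ⟨t, by simpa [sq] using ht, fun G => ?_⟩
  unfold GraphProperty.CorrectOn
  rw [e, decide_eq_true_iff]
  refine ⟨?_, fun h => ⟨G, h, rfl⟩⟩
  rintro ⟨H, hH, h⟩
  have : edgeBit G = edgeBit H := by
    funext p
    exact List.map_inj_left.1 h p (by simp)
  rwa [edgeBit_injective this]

/-- The permutation `(i, b, m) ↦ (σ i, m i, m[i := b])`. -/
def recordPerm {I : Type} [DecidableEq I] (σ : Equiv.Perm I) :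
    Equiv.Perm (I × Bool × (I → Bool)) where
  toFun s := (σ s.1, s.2.2 s.1, Function.update s.2.2 s.1 s.2.1)
  invFun s := (σ.symm s.1, s.2.2 (σ.symm s.1),
    Function.update s.2.2 (σ.symm s.1) s.2.1)
  left_inv := by rintro ⟨i, b, m⟩; simp
  right_inv := by rintro ⟨i, b, m⟩; simp

theorem GraphProperty.exists_quantumAlgorithm (P : GraphProperty) (n : ℕ) (hn : 0 < n) :
    ∃ A : QuantumAlgorithm (Fin n × Fin n), P.QuantumDecides n A (n ^ 2) := by
  classical
  let I := Fin n × Fin n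
  let e : I ≃ Fin (n ^ 2) := Fintype.equivFinOfCardEq (by simp [I, sq])
  let j : ℕ → I := fun t => if h : t < n ^ 2 then e.symm ⟨t, h⟩ else (⟨0, hn⟩, ⟨0, hn⟩)
  let A : QuantumAlgorithm I :=
    { Work := I → Bool
      init := EuclideanSpace.single (j 0, false, fun _ => false) 1
      norm_init := by simp
      step := fun t => LinearIsometryEquiv.piLpCongrLeft 2 ℂ ℂ
        (recordPerm (Equiv.swap (j t) (j (t + 1))))
      accept := {s | ∃ G : SimpleGraph (Fin n), P.Holds n G ∧ s.2.2 = edgeBit G} }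
  have key : ∀ (x : I → Bool) (t : ℕ), t ≤ n ^ 2 → A.state x t =
      EuclideanSpace.single (j t, false, fun i => if (e i : ℕ) < t then x i else false) 1 := by
    intro x t
    induction t with
    | zero => intro _; simp [QuantumAlgorithm.state, A]
    | succ t ih =>
      intro ht
      have hlt : t < n ^ 2 := ht
      have hj : ((e (j t) : Fin (n ^ 2)) : ℕ) = t := by simp [j, hlt]
      rw [QuantumAlgorithm.state, ih hlt.le, oracle]
      change LinearIsometryEquiv.piLpCongrLeft 2 ℂ ℂ _ _ = _
      erw [LinearIsometryEquiv.piLpCongrLeft_single, LinearIsometryEquiv.piLpCongrLeft_single]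
      congr 1
      refine Prod.ext ?_ (Prod.ext ?_ ?_)
      · change Equiv.swap (j t) (j (t + 1)) (j t) = _
        simp
      · change (if (e (j t) : ℕ) < t then x (j t) else false) = false
        simp [hj]
      change Function.update (fun i => if (e i : ℕ) < t then x i else false) (j t)
        (xor false (x (j t))) = fun i => if (e i : ℕ) < t + 1 then x i else false
      funext i
      by_cases hi : i = j t
      · subst hi; simp [hj]
      · have : (e i : ℕ) ≠ t := by
          intro h
          exact hi (e.injective (Fin.ext (h.trans hj.symm)))
        have h2 : (e i : ℕ) < t + 1 ↔ (e i : ℕ) < t := by omega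
        simp [Function.update_of_ne hi, h2]
  have hacc : ∀ G : SimpleGraph (Fin n), A.acceptProb (edgeBit G) (n ^ 2) =
      if P.Holds n G then 1 else 0 := by
    intro G
    have hs : A.state (edgeBit G) (n ^ 2) =
        EuclideanSpace.single (j (n ^ 2), false, edgeBit G) 1 := by
      rw [key _ _ le_rfl]
      simp
    have hm : ((j (n ^ 2), false, edgeBit G) : I × Bool × A.Work) ∈ A.accept ↔ P.Holds n G := by
      refine ⟨?_, fun h => ⟨G, h, rfl⟩⟩
      rintro ⟨H, hH, h⟩
      rwa [edgeBit_injective h]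
    rw [QuantumAlgorithm.acceptProb, hs,
      Finset.sum_eq_single ((j (n ^ 2), false, edgeBit G) : I × Bool × A.Work)]
    · by_cases h : P.Holds n G
      · rw [if_pos (hm.2 h), if_pos h]; simp
      · rw [if_neg (fun h' => h (hm.1 h')), if_neg h]
    · intro b _ hb
      simp [hb]
    · simp
  refine ⟨A, fun G => ⟨fun h => ?_, fun h => ?_⟩⟩
  · rw [hacc, if_pos h]; norm_num
  · rw [hacc, if_neg h]; norm_num

/-! It suffices to find, for all large `n`, a graph with the property and order `n ^ 2` single
edges, any one of which destroys it. Testing for such an edge is unstructured search among order `n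
^ 2` items, which costs order `n ^ 2` randomized and order `n` quantum queries.

The graphs come from three successive minimal choices (`exists_critical_hubStars`). A large clique
is forbidden, so some clique of hubs joined to an independent set is forbidden; with the fewest
hubs, removing one hub makes every such graph allowed. The centre of a star can replace the missing
hub, so the remaining hubs joined to a large star are forbidden. Next, minimize the size of the
equal stars that, in some number, are forbidden; call it `d + 1`. Finally, minimize the number `s +
1` of stars of size `d + 1` that, together with some number of stars of size `d`, are forbidden.
Then `s` large stars with arbitrarily many small ones are allowed, but an edge between two small
centres makes a further large star. Two groups of linearly many small centres supply the edges. -/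

namespace QuantumAlgorithm

/-! ### Quantum search lower bound: the hybrid argument -/

variable {I : Type} [Fintype I]

theorem oracle_apply {W : Type} [Fintype W] (x : I → Bool) (ψ : EuclideanSpace ℂ (I × Bool × W))
    (s : I × Bool × W) : oracle x ψ s = ψ (s.1, xor s.2.1 (x s.1), s.2.2) := rfl

open Classical in
/-- The component of a state on the queries at which the black boxes `x` and `y` differ. -/
noncomputable def restrictDiff {W : Type} (x y : I → Bool)
    (ψ : EuclideanSpace ℂ (I × Bool × W)) : EuclideanSpace ℂ (I × Bool × W) :=
  WithLp.toLp 2 fun s => if x s.1 ≠ y s.1 then ψ s else 0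

/-- Where the black boxes agree their actions cancel, so only the restricted component matters; both
oracles are isometries. -/
theorem norm_oracle_sub_oracle_le {W : Type} [Fintype W] (x y : I → Bool)
    (ψ : EuclideanSpace ℂ (I × Bool × W)) :
    ‖oracle x ψ - oracle y ψ‖ ≤ 2 * ‖restrictDiff x y ψ‖ := by
  have h : oracle x ψ - oracle y ψ =
      oracle x (restrictDiff x y ψ) - oracle y (restrictDiff x y ψ) := by
    ext s
    by_cases hs : x s.1 = y s.1
    · simp [oracle_apply, restrictDiff, hs]
    · simp [oracle_apply, restrictDiff, hs]
  rw [h]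
  refine (norm_sub_le _ _).trans ?_
  simp [two_mul]

variable (A : QuantumAlgorithm I)

theorem norm_state (x : I → Bool) (t : ℕ) : ‖A.state x t‖ = 1 := by
  induction t with
  | zero => exact A.norm_init
  | succ t ih => simp [state, ih]

/-- The runs drift apart only at queries, and unitaries preserve the drift so far. Only the run on
`x` enters the bound, so one run serves all `y`. -/
theorem norm_state_sub_state_le (x y : I → Bool) (T : ℕ) :
    ‖A.state x T - A.state y T‖ ≤
      ∑ t ∈ Finset.range T, 2 * ‖restrictDiff x y (A.state x t)‖ := by
  induction T with
  | zero => simp [state]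
  | succ T ih =>
    rw [Finset.sum_range_succ, state, state, ← map_sub, LinearIsometryEquiv.norm_map]
    calc ‖oracle x (A.state x T) - oracle y (A.state y T)‖
        = ‖(oracle x (A.state x T) - oracle y (A.state x T)) +
            oracle y (A.state x T - A.state y T)‖ := by rw [map_sub]; congr 1; abel
      _ ≤ ‖oracle x (A.state x T) - oracle y (A.state x T)‖ +
            ‖oracle y (A.state x T - A.state y T)‖ := norm_add_le _ _
      _ ≤ _ := by
        rw [LinearIsometryEquiv.norm_map, add_comm]
        exact add_le_add ih (norm_oracle_sub_oracle_le _ _ _)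

open Classical in
/-- The component of a state on the accepting outcomes. -/
noncomputable def acceptPart (ψ : EuclideanSpace ℂ (I × Bool × A.Work)) :
    EuclideanSpace ℂ (I × Bool × A.Work) :=
  WithLp.toLp 2 fun s => if s ∈ A.accept then ψ s else 0

theorem norm_acceptPart_le (ψ : EuclideanSpace ℂ (I × Bool × A.Work)) :
    ‖A.acceptPart ψ‖ ≤ ‖ψ‖ := by
  rw [EuclideanSpace.norm_eq, EuclideanSpace.norm_eq]
  refine Real.sqrt_le_sqrt (Finset.sum_le_sum fun s _ => ?_)
  simp only [acceptPart]
  split_ifs <;> simp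

theorem acceptProb_eq (x : I → Bool) (T : ℕ) :
    A.acceptProb x T = ‖A.acceptPart (A.state x T)‖ ^ 2 := by
  rw [EuclideanSpace.norm_sq_eq, acceptProb]
  refine Finset.sum_congr rfl fun s _ => ?_
  simp only [acceptPart]
  split_ifs <;> simp

theorem acceptPart_sub (φ ψ : EuclideanSpace ℂ (I × Bool × A.Work)) :
    A.acceptPart (φ - ψ) = A.acceptPart φ - A.acceptPart ψ := by
  ext s
  simp only [acceptPart, PiLp.sub_apply]
  split_ifs <;> simp

theorem acceptProb_sub_le (x y : I → Bool) (T : ℕ) :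
    A.acceptProb x T - A.acceptProb y T ≤ 2 * ‖A.state x T - A.state y T‖ := by
  rw [acceptProb_eq, acceptProb_eq]
  have hx := (A.norm_acceptPart_le (A.state x T)).trans_eq (A.norm_state x T)
  have hy := (A.norm_acceptPart_le (A.state y T)).trans_eq (A.norm_state y T)
  have h : ‖A.acceptPart (A.state x T)‖ - ‖A.acceptPart (A.state y T)‖ ≤
      ‖A.state x T - A.state y T‖ :=
    (norm_sub_norm_le _ _).trans (by rw [← acceptPart_sub]; exact A.norm_acceptPart_le _)
  have h0 := norm_nonneg (A.state x T - A.state y T)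
  nlinarith [norm_nonneg (A.acceptPart (A.state x T)), norm_nonneg (A.acceptPart (A.state y T))]

/-- The difference sets are disjoint, so each basis state is counted at most once. -/
theorem sum_norm_restrictDiff_sq_le {W K : Type} [Fintype W] [Fintype K] (x : I → Bool)
    (y : K → I → Bool) (hy : ∀ i k l, x i ≠ y k i → x i ≠ y l i → k = l)
    (ψ : EuclideanSpace ℂ (I × Bool × W)) :
    ∑ k, ‖restrictDiff x (y k) ψ‖ ^ 2 ≤ ‖ψ‖ ^ 2 := by
  classical
  simp only [EuclideanSpace.norm_sq_eq]
  rw [Finset.sum_comm]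
  refine Finset.sum_le_sum fun s _ => ?_
  by_cases h : ∃ k, x s.1 ≠ y k s.1
  · obtain ⟨k, hk⟩ := h
    rw [Finset.sum_eq_single k]
    · simp [restrictDiff, hk]
    · intro l _ hl
      have : x s.1 = y l s.1 := by
        by_contra h'
        exact hl (hy _ _ _ h' hk)
      simp [restrictDiff, this]
    · simp
  · push Not at h
    rw [Finset.sum_eq_zero]
    · positivity
    · intro k _
      simp [restrictDiff, h k]

/-- The hybrid argument: a quantum algorithm that tells `x` from each of the black boxes `y k`,
which differ from `x` on disjoint sets of queries, makes a number of queries of the order of the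
square root of the number of these black boxes. -/
theorem card_le_of_distinguishes {K : Type} [Fintype K] (x : I → Bool)
    (y : K → I → Bool) (hy : ∀ i k l, x i ≠ y k i → x i ≠ y l i → k = l) (T : ℕ)
    (hx : 2 / 3 ≤ A.acceptProb x T) (hK : ∀ k, A.acceptProb (y k) T ≤ 1 / 3) :
    (Fintype.card K : ℝ) ≤ 144 * (T : ℝ) ^ 2 := by
  have key : ∀ k, (1 / 144 : ℝ) ≤
      T * ∑ t ∈ Finset.range T, ‖restrictDiff x (y k) (A.state x t)‖ ^ 2 := by
    intro k
    have h1 := A.acceptProb_sub_le x (y k) T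
    have h2 := A.norm_state_sub_state_le x (y k) T
    rw [← Finset.mul_sum] at h2
    -- The gap `1 / 3` in acceptance loses a factor 2 in passing to states and another 2 in passing
    -- to query weights. Cauchy–Schwarz over the `T` queries then squares `1 / 12`.
    have h3 : (1 / 12 : ℝ) ≤
        ∑ t ∈ Finset.range T, ‖restrictDiff x (y k) (A.state x t)‖ := by
      linarith [hK k]
    have h4 := sq_sum_le_card_mul_sum_sq (s := Finset.range T)
      (f := fun t => ‖restrictDiff x (y k) (A.state x t)‖)
    rw [Finset.card_range] at h4
    refine le_trans ?_ h4
    calc (1 / 144 : ℝ) = (1 / 12) ^ 2 := by norm_num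
      _ ≤ _ := by gcongr
  have hsum : ∑ _k : K, (1 / 144 : ℝ) ≤
      ∑ k, T * ∑ t ∈ Finset.range T, ‖restrictDiff x (y k) (A.state x t)‖ ^ 2 :=
    Finset.sum_le_sum fun k _ => key k
  rw [← Finset.mul_sum, Finset.sum_comm] at hsum
  have hT : ∑ t ∈ Finset.range T, ∑ k, ‖restrictDiff x (y k) (A.state x t)‖ ^ 2 ≤ T := by
    refine (Finset.sum_le_sum fun t _ => sum_norm_restrictDiff_sq_le x y hy _).trans ?_
    simp [norm_state]
  have := hsum.trans (mul_le_mul_of_nonneg_left hT (Nat.cast_nonneg T))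
  simp only [Finset.sum_const, Finset.card_univ, nsmul_eq_mul] at this
  linarith

end QuantumAlgorithm

/-! ### Randomized search lower bound -/

namespace DecisionTree

variable {I : Type}

/-- The queries made on the black box `x`. -/
def path (x : I → Bool) : DecisionTree I → List I
  | leaf _ => []
  | query i t₀ t₁ => i :: if x i then t₁.path x else t₀.path x

theorem length_path_le (x : I → Bool) (t : DecisionTree I) : (t.path x).length ≤ t.depth := by
  induction t with
  | leaf b => simp [path]
  | query i t₀ t₁ h₀ h₁ =>
    simp only [path, depth, List.length_cons]
    split_ifs <;> omega

theorem eval_congr {x y : I → Bool} (t : DecisionTree I) (h : ∀ i ∈ t.path x, x i = y i) :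
    t.eval x = t.eval y := by
  induction t with
  | leaf b => rfl
  | query i t₀ t₁ h₀ h₁ =>
    simp only [path, List.mem_cons, forall_eq_or_imp] at h
    simp only [eval, ← h.1]
    split_ifs with hi
    · exact h₁ (by simpa [hi] using h.2)
    · exact h₀ (by simpa [hi] using h.2)

open Classical in
-- By disjointness, each query on the path lands in at most one difference set.
theorem card_le_depth {K : Type} [Fintype K] (x : I → Bool) (y : K → I → Bool)
    (hy : ∀ i k l, x i ≠ y k i → x i ≠ y l i → k = l) (t : DecisionTree I) :
    (Finset.univ.filter fun k => ∃ i ∈ t.path x, x i ≠ y k i).card ≤ t.depth := by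
  refine le_trans ?_ ((List.toFinset_card_le (t.path x)).trans (t.length_path_le x))
  refine Finset.card_le_card_of_forall_subsingleton (fun k i => x i ≠ y k i) ?_ ?_
  · intro k hk
    simpa using hk
  · rintro i - k ⟨-, hk⟩ l ⟨-, hl⟩
    exact hy i k l hk hl

end DecisionTree

/-- A randomized algorithm that tells `x` from each of the black boxes `y k`, which differ from `x`
on disjoint sets of queries, makes a number of queries of the order of the number of these black
boxes. -/
theorem PMF.card_le_of_distinguishes {I K : Type} [Fintype K] (x : I → Bool) (y : K → I → Bool)
    (hy : ∀ i k l, x i ≠ y k i → x i ≠ y l i → k = l) (μ : PMF (DecisionTree I)) (q : ℕ)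
    (hμ : ∀ t ∈ μ.support, t.depth ≤ q)
    (hx : (2 / 3 : ℝ≥0∞) ≤ μ.toOuterMeasure {t | t.eval x = true})
    (hK : ∀ k, (2 / 3 : ℝ≥0∞) ≤ μ.toOuterMeasure {t | ¬ t.eval (y k) = true}) :
    Fintype.card K ≤ 3 * q := by
  classical
  let Q : K → Set (DecisionTree I) := fun k => {t | ∃ i ∈ t.path x, x i ≠ y k i}
  have key : ∀ k, (1 / 3 : ℝ≥0∞) ≤ ∑' t, (Q k).indicator μ t := by
    intro k
    -- A tree that misses the `k`-th difference set on `x` answers alike on `x` and `y k`, so it is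
    -- right on at most one of them. Hence `4 / 3` is at most 1 plus the probability of a hit.
    have h1 : ∑' t, {t | t.eval x = true}.indicator μ t +
        ∑' t, {t | ¬ t.eval (y k) = true}.indicator μ t ≤ 1 + ∑' t, (Q k).indicator μ t := by
      rw [← ENNReal.tsum_add, ← μ.tsum_coe, ← ENNReal.tsum_add]
      refine ENNReal.tsum_le_tsum fun t => ?_
      by_cases hQ : t ∈ Q k
      · rw [Set.indicator_of_mem hQ]
        exact add_le_add (Set.indicator_le_self _ _ _) (Set.indicator_le_self _ _ _)
      · have he : t.eval x = t.eval (y k) := by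
          refine t.eval_congr fun i hi => ?_
          by_contra h
          exact hQ ⟨i, hi, h⟩
        simp only [Set.indicator_apply, Set.mem_ofPred_eq, he, hQ]
        split_ifs <;> simp
    have h2 : (2 / 3 : ℝ≥0∞) + 2 / 3 ≤ 1 + ∑' t, (Q k).indicator μ t :=
      (add_le_add (by simpa [PMF.toOuterMeasure_apply] using hx)
        (by simpa [PMF.toOuterMeasure_apply] using hK k)).trans h1
    have h3 : (2 / 3 : ℝ≥0∞) + 2 / 3 = 1 + 1 / 3 := by
      calc (2 / 3 : ℝ≥0∞) + 2 / 3 = (3 + 1) / 3 := by rw [ENNReal.div_add_div_same]; norm_num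
        _ = 1 + 1 / 3 := by rw [ENNReal.add_div, ENNReal.div_self (by simp) (by simp)]
    rw [h3] at h2
    exact (ENNReal.add_le_add_iff_left ENNReal.one_ne_top).1 h2
  have hsum : (Fintype.card K : ℝ≥0∞) * (1 / 3) ≤ q := by
    calc (Fintype.card K : ℝ≥0∞) * (1 / 3) = ∑ _k : K, (1 / 3 : ℝ≥0∞) := by simp
      _ ≤ ∑ k, ∑' t, (Q k).indicator μ t := Finset.sum_le_sum fun k _ => key k
      _ = ∑' t, ∑ k, (Q k).indicator μ t := by
        simp only [← tsum_fintype (L := .unconditional _)]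
        exact ENNReal.tsum_comm
      _ ≤ ∑' t, (q : ℝ≥0∞) * μ t := by
        refine ENNReal.tsum_le_tsum fun t => ?_
        by_cases ht : t ∈ μ.support
        · have : ∑ k, (Q k).indicator μ t =
              ((Finset.univ.filter fun k => ∃ i ∈ t.path x, x i ≠ y k i).card : ℝ≥0∞) * μ t := by
            simp [Set.indicator_apply, Q, ← Finset.sum_filter]
          rw [this]
          gcongr
          exact (t.card_le_depth x y hy).trans (hμ t ht)
        · have : μ t = 0 := by simpa using ht
          simp [Set.indicator_apply, this]
      _ = q := by rw [ENNReal.tsum_mul_left, μ.tsum_coe, mul_one]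
  have h3 : (Fintype.card K : ℝ≥0∞) ≤ ((3 * q : ℕ) : ℝ≥0∞) := by
    rw [mul_one_div, ENNReal.div_le_iff (by simp) (by simp)] at hsum
    rw [mul_comm]
    exact_mod_cast hsum
  exact_mod_cast h3

/-! ### Containments between hub-and-star graphs -/

/-- The relation generating `hubStars`. -/
def hubStarsRel (c M : ℕ) {ι : Type} (f : ι → ℕ) :
    Fin c ⊕ ι × Fin (M + 1) → Fin c ⊕ ι × Fin (M + 1) → Prop
  | .inl _, _ => True
  | .inr _, .inl _ => False
  | .inr p, .inr q => p.1 = q.1 ∧ p.2 = 0 ∧ (q.2 : ℕ) ≤ f p.1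

/-- A clique on `c` hubs, joined completely to blocks of `M + 1` vertices; in the block `i`, the
vertex `0` is the centre of a star with leaves `1, …, f i`, and the other vertices are isolated. -/
def hubStars (c M : ℕ) {ι : Type} (f : ι → ℕ) : SimpleGraph (Fin c ⊕ ι × Fin (M + 1)) :=
  SimpleGraph.fromRel (hubStarsRel c M f)

section hubStars

variable {c M : ℕ} {ι : Type} {f : ι → ℕ}

theorem hubStars_adj_hub {h : Fin c} {v : Fin c ⊕ ι × Fin (M + 1)} (hv : Sum.inl h ≠ v) :
    (hubStars c M f).Adj (.inl h) v :=
  (SimpleGraph.fromRel_adj _ _ _).2 ⟨hv, .inl trivial⟩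

theorem hubStars_adj_leaf {i : ι} {b : Fin (M + 1)} (hb : b ≠ 0) (h : (b : ℕ) ≤ f i) :
    (hubStars c M f).Adj (.inr (i, 0)) (.inr (i, b)) :=
  (SimpleGraph.fromRel_adj _ _ _).2 ⟨by simpa using hb.symm, .inl ⟨rfl, rfl, h⟩⟩

theorem hubStars_le_comap {W : Type} {G : SimpleGraph W} (φ : Fin c ⊕ ι × Fin (M + 1) → W)
    (hφ : Function.Injective φ) (hhub : ∀ h v, φ (.inl h) ≠ φ v → G.Adj (φ (.inl h)) (φ v))
    (hleaf : ∀ (i : ι) (b : Fin (M + 1)), b ≠ 0 → (b : ℕ) ≤ f i →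
      G.Adj (φ (.inr (i, 0))) (φ (.inr (i, b)))) :
    hubStars c M f ≤ G.comap φ := by
  have key : ∀ u v, u ≠ v → hubStarsRel c M f u v → G.Adj (φ u) (φ v) := by
    rintro (h | ⟨i, a⟩) (h' | ⟨k, b⟩) hne huv
    · exact hhub _ _ (hφ.ne hne)
    · exact hhub _ _ (hφ.ne hne)
    · exact huv.elim
    · obtain ⟨h1, h2, h3⟩ := huv
      simp only at h1 h2 h3
      subst h1 h2
      exact hleaf _ _ (by rintro rfl; exact hne rfl) h3
  intro u v huv
  obtain ⟨hne, huv | hvu⟩ := (SimpleGraph.fromRel_adj _ _ _).1 huv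
  · exact key _ _ hne huv
  · exact (key _ _ hne.symm hvu).symm

theorem hubStars_isContained {W : Type} {G : SimpleGraph W} (φ : Fin c ⊕ ι × Fin (M + 1) → W)
    (hφ : Function.Injective φ) (hhub : ∀ h v, φ (.inl h) ≠ φ v → G.Adj (φ (.inl h)) (φ v))
    (hleaf : ∀ (i : ι) (b : Fin (M + 1)), b ≠ 0 → (b : ℕ) ≤ f i →
      G.Adj (φ (.inr (i, 0))) (φ (.inr (i, b)))) :
    hubStars c M f ⊑ G :=
  ⟨⟨⟨φ, fun h => hubStars_le_comap φ hφ hhub hleaf h⟩, hφ⟩⟩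

theorem hubStars_le_comap_of_embedding {κ : Type} {g : κ → ℕ} (e : ι ↪ κ)
    (h : ∀ i, f i ≤ g (e i)) : hubStars c M f ≤
      (hubStars c M g).comap ((Function.Embedding.refl _).sumMap (e.prodMap (.refl _))) := by
  refine hubStars_le_comap _ (Function.Embedding.injective _) ?_ ?_
  · intro _ v hv
    exact hubStars_adj_hub hv
  · intro i b hb hbi
    exact hubStars_adj_leaf hb (hbi.trans (h i))

/-- Without star edges a block falls apart into single vertices. This carries the minimality of the
hub number, stated for one-vertex blocks, over to blocks with room for stars. -/
theorem hubStars_zero_isContained (c M N : ℕ) :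
    hubStars c M (fun _ : Fin N => 0) ⊑ hubStars c 0 (fun _ : Fin (N * (M + 1)) => 0) := by
  refine hubStars_isContained (Sum.map id fun p => (finProdFinEquiv p, 0))
    (Function.injective_id.sumMap fun p q h => by simpa using h) ?_ ?_
  · intro _ v hv
    exact hubStars_adj_hub hv
  · intro i b hb hbi
    exact (hb (Fin.ext (by simpa using hbi))).elim

/-- The centre of the star plays the extra hub: it sees all other hubs and, as leaves, all the
independent vertices. -/
theorem hubStars_succ_isContained (c N : ℕ) :
    hubStars (c + 1) 0 (fun _ : Fin N => 0) ⊑ hubStars c N (fun _ : Fin 1 => N) := by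
  let φ : Fin (c + 1) ⊕ Fin N × Fin (0 + 1) → Fin c ⊕ Fin 1 × Fin (N + 1) :=
    Sum.elim (Fin.lastCases (.inr (0, 0)) fun h => .inl h) fun p => .inr (0, p.1.succ)
  have hφ : Function.Injective φ := by
    rintro (h | ⟨i, a⟩) (h' | ⟨k, b⟩) hh
    · induction h using Fin.lastCases <;> induction h' using Fin.lastCases <;>
        simp_all [φ]
    · induction h using Fin.lastCases <;> simp [φ] at hh
      exact absurd hh.symm (Fin.succ_ne_zero _)
    · induction h' using Fin.lastCases <;> simp [φ] at hh
    · have : a = b := Subsingleton.elim (α := Fin 1) a b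
      simp_all [φ]
  refine hubStars_isContained φ hφ ?_ ?_
  · intro h v hv
    induction h using Fin.lastCases with
    | cast h =>
      simp only [φ, Sum.elim_inl, Fin.lastCases_castSucc] at hv ⊢
      exact hubStars_adj_hub hv
    | last =>
      simp only [φ, Sum.elim_inl, Fin.lastCases_last] at hv ⊢
      rcases v with h' | ⟨k, b⟩
      · induction h' using Fin.lastCases with
        | cast h' =>
          simp only [Sum.elim_inl, Fin.lastCases_castSucc] at hv ⊢
          exact (hubStars_adj_hub hv.symm).symm
        | last => simp at hv
      · exact hubStars_adj_leaf (Fin.succ_ne_zero _) (by simp)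
  · intro i b hb
    exact (hb (Subsingleton.elim (α := Fin 1) b 0)).elim

/-- Joining the centres of two stars with `d` leaves completes one more star with `d + 1`
leaves. -/
theorem hubStars_isContained_sup_edge (c M d s N : ℕ) {X : Type} {i j : X} (hij : i ≠ j) :
    hubStars c M (fun k : Fin N => if (k : ℕ) < s + 1 then d + 1 else d) ⊑
      hubStars c M (Sum.elim (fun k : Fin N => if (k : ℕ) < s then d + 1 else d)
        fun _ : X => d) ⊔ SimpleGraph.edge (.inr (.inr i, 0)) (.inr (.inr j, 0)) := by
  -- Block `s` moves to block `i`, except that its leaf `d + 1` goes to the centre of block `j`; all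
  -- other blocks stay in place.
  let φ₀ : Fin N × Fin (M + 1) → (Fin N ⊕ X) × Fin (M + 1) := fun p => if (p.1 : ℕ) = s then
      (if (p.2 : ℕ) = d + 1 then (.inr j, 0) else (.inr i, p.2)) else (.inl p.1, p.2)
  have hφ₀ : Function.Injective φ₀ := by
    rintro ⟨k, a⟩ ⟨l, b⟩ h
    simp only [φ₀] at h
    rw [Prod.mk.injEq, Fin.ext_iff, Fin.ext_iff]
    split_ifs at h <;>
      simp only [Prod.mk.injEq, Sum.inl.injEq, Sum.inr.injEq, reduceCtorEq, false_and,
        Fin.ext_iff, hij, hij.symm] at h <;> omega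
  refine hubStars_isContained (Sum.map id φ₀) (Function.injective_id.sumMap hφ₀) ?_ ?_
  · intro _ v hv
    exact .inl (hubStars_adj_hub hv)
  · intro k b hb hk
    simp only [Sum.map_inr, φ₀, Fin.val_zero, (Nat.succ_ne_zero d).symm, if_false]
    by_cases hks : (k : ℕ) = s
    · rw [if_pos (by omega)] at hk
      rw [if_pos hks, if_pos hks]
      split_ifs with hbd
      · exact .inr ((SimpleGraph.edge_adj ..).2 ⟨.inl ⟨rfl, rfl⟩, by simpa using hij⟩)
      · exact .inl (hubStars_adj_leaf hb (by simp only [Sum.elim_inr]; omega))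
    · rw [if_neg hks, if_neg hks]
      refine .inl (hubStars_adj_leaf hb ?_)
      simp only [Sum.elim_inl]
      split_ifs at hk ⊢ <;> omega

/-- Renumbering the blocks. If `N < s`, some blocks from `X` may receive larger stars, which only
adds edges. -/
theorem hubStars_sumElim_isContained (c M d s N : ℕ) (X : Type) [Fintype X] :
    hubStars c M (Sum.elim (fun k : Fin N => if (k : ℕ) < s then d + 1 else d)
        fun _ : X => d) ⊑
      hubStars c M (fun k : Fin (N + Fintype.card X) => if (k : ℕ) < s then d + 1 else d) := by
  refine SimpleGraph.isContained_iff_exists_le_comap.2 ⟨_, hubStars_le_comap_of_embedding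
    (((Equiv.refl _).sumCongr (Fintype.equivFin X)).trans finSumFinEquiv).toEmbedding ?_⟩
  rintro (k | x)
  · simp
  · simp only [Sum.elim_inr]
    split_ifs <;> omega

end hubStars

/-! ### Critical forbidden graphs and sensitivity -/

namespace GraphProperty

variable (P : GraphProperty)

/-- No graph with the property contains `G`. -/
def Forbids {V : Type} (G : SimpleGraph V) : Prop :=
  ∀ (n : ℕ) (H : SimpleGraph (Fin n)), G ⊑ H → ¬ P.Holds n H

variable {P}

theorem Forbids.mono {V W : Type} {G : SimpleGraph V} {H : SimpleGraph W} (hG : P.Forbids G)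
    (h : G ⊑ H) : P.Forbids H :=
  fun n K hK => hG n K (h.trans hK)

theorem SubgraphClosed.holds_of_not_forbids (hsub : P.SubgraphClosed) {V : Type}
    {G : SimpleGraph V} (hG : ¬ P.Forbids G) {m : ℕ} (hm : 0 < m) {H : SimpleGraph (Fin m)}
    (h : H ⊑ G) : P.Holds m H := by
  unfold Forbids at hG
  push Not at hG
  obtain ⟨n, K, hK, hP⟩ := hG
  exact hsub m n H K hm (h.trans hK) hP

/-- There are arbitrarily large allowed graphs to which the addition of any edge between the
centres of two distinguished stars yields a forbidden graph. -/
theorem exists_critical_hubStars (hP : P.Nontrivial) (hsub : P.SubgraphClosed) :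
    ∃ c M d s N : ℕ,
      (∀ N' : ℕ, ¬ P.Forbids (hubStars c M
        (fun k : Fin N' => if (k : ℕ) < s then d + 1 else d))) ∧
      P.Forbids (hubStars c M (fun k : Fin N => if (k : ℕ) < s + 1 then d + 1 else d)) := by
  classical
  obtain ⟨n₀, hn₀⟩ := hP
  -- A clique on `n₀ + 1` vertices contains a graph without the property.
  have hc : ∃ c N, P.Forbids (hubStars c 0 (fun _ : Fin N => 0)) := by
    refine ⟨n₀ + 1, 0, fun n H hH hPH => ?_⟩
    obtain ⟨-, G, hG⟩ := hn₀ (n₀ + 1) (by omega)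
    refine hG (hsub _ _ _ _ (by omega) (.trans ⟨⟨⟨Sum.inl, fun {u v} huv => ?_⟩,
      Sum.inl_injective⟩⟩ hH) hPH)
    exact hubStars_adj_hub (Sum.inl_injective.ne huv.ne)
  -- With no hubs the graph is edgeless and lies in every graph with enough vertices, some of which
  -- have the property.
  have hc0 : Nat.find hc ≠ 0 := by
    intro h0
    obtain ⟨N, hN⟩ := Nat.find_spec hc
    rw [h0] at hN
    obtain ⟨⟨G, hG⟩, -⟩ := hn₀ (n₀ + 1 + N) (by omega)
    refine hN _ G (hubStars_isContained (Sum.elim Fin.elim0 fun p => Fin.natAdd _ p.1) ?_ ?_ ?_) hG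
    · rintro (h | ⟨i, a⟩) (h' | ⟨k, b⟩) hh
      · exact h.elim0
      · exact h.elim0
      · exact h'.elim0
      · have : a = b := Subsingleton.elim (α := Fin 1) a b
        simp_all
    · exact fun h => h.elim0
    · intro i b hb
      exact (hb (Subsingleton.elim (α := Fin 1) b 0)).elim
  obtain ⟨c, hcc⟩ := Nat.exists_eq_succ_of_ne_zero hc0
  -- From here on blocks have `M + 1` vertices, enough for a star with `M` leaves.
  obtain ⟨M, hM⟩ := Nat.find_spec hc
  rw [hcc] at hM
  have hcmin : ∀ N, ¬ P.Forbids (hubStars c M (fun _ : Fin N => 0)) := fun N hN =>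
    Nat.find_min hc (m := c) (by omega) ⟨_, hN.mono (hubStars_zero_isContained c M N)⟩
  have hd : ∃ d N, P.Forbids (hubStars c M (fun _ : Fin N => d)) :=
    ⟨M, 1, hM.mono (hubStars_succ_isContained c M)⟩
  have hd0 : Nat.find hd ≠ 0 := by
    intro h0
    obtain ⟨N, hN⟩ := Nat.find_spec hd
    rw [h0] at hN
    exact hcmin N hN
  obtain ⟨d, hdd⟩ := Nat.exists_eq_succ_of_ne_zero hd0
  obtain ⟨N₀, hN₀⟩ := Nat.find_spec hd
  rw [hdd] at hN₀
  have hs : ∃ s N, P.Forbids (hubStars c M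
      (fun k : Fin N => if (k : ℕ) < s then d + 1 else d)) := by
    refine ⟨N₀, N₀, ?_⟩
    convert hN₀ with k
    simp
  have hs0 : Nat.find hs ≠ 0 := by
    intro h0
    obtain ⟨N, hN⟩ := Nat.find_spec hs
    rw [h0] at hN
    exact Nat.find_min hd (m := d) (by omega) ⟨N, by simpa using hN⟩
  obtain ⟨s, hss⟩ := Nat.exists_eq_succ_of_ne_zero hs0
  obtain ⟨N, hN⟩ := Nat.find_spec hs
  rw [hss] at hN
  exact ⟨c, M, d, s, N, fun N' hN' => Nat.find_min hs (m := s) (by omega) ⟨N', hN'⟩, hN⟩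

/-- `P` is hard on `n` vertices in the following sense: it holds for a graph to which one can add
any one of `R ^ 2` edges, after which it does not hold any more. -/
def IsSensitive (P : GraphProperty) (n R : ℕ) : Prop :=
  ∃ (A : SimpleGraph (Fin n)) (w z : Fin R → Fin n), w.Injective ∧ z.Injective ∧
    (∀ i j, w i ≠ z j) ∧ P.Holds n A ∧ ∀ i j, ¬ P.Holds n (A ⊔ SimpleGraph.edge (w i) (z j))

/-- Enlarge the image of `V` to exactly `n` elements. This trims an oversized allowed graph to order
`n` while keeping a prescribed core. -/
theorem _root_.Function.Embedding.exists_factor_through_fin {V W : Type} [Fintype V] [Fintype W]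
    (e : V ↪ W) {n : ℕ} (h : Fintype.card V ≤ n) (h' : n ≤ Fintype.card W) :
    ∃ (p : V ↪ Fin n) (q : Fin n ↪ W), ∀ v, q (p v) = e v := by
  classical
  obtain ⟨S, hVS, -, hS⟩ := Finset.exists_subsuperset_card_eq
    (s := Finset.univ.map e) (t := Finset.univ) (n := n) (Finset.subset_univ _)
    (by simpa using h) (by simpa using h')
  let r : S ≃ Fin n := S.equivFinOfCardEq hS
  refine ⟨⟨fun v => r ⟨e v, hVS (by simp)⟩, fun u v h => by simpa using h⟩,
    ⟨fun x => r.symm x, Subtype.val_injective.comp r.symm.injective⟩, fun v => ?_⟩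
  exact congrArg Subtype.val (r.symm_apply_apply _)

theorem exists_isSensitive (hP : P.Nontrivial) (hsub : P.SubgraphClosed) :
    ∃ a b : ℕ, 0 < b ∧ ∀ n R, 0 < n → a + b * R ≤ n → P.IsSensitive n R := by
  obtain ⟨c, M, d, s, N, hall, hforb⟩ := exists_critical_hubStars hP hsub
  -- The core consists of the hubs, `N` blocks for the forbidden graph and `2 * R` blocks whose
  -- centres get joined. The `Fin n` further blocks in `B` are padding to reach order `n`.
  refine ⟨c + N * (M + 1), 2 * (M + 1), by positivity, fun n R hn hR => ?_⟩
  let m : Fin N ⊕ (Fin R ⊕ Fin R) ↪ Fin N ⊕ ((Fin R ⊕ Fin R) ⊕ Fin n) :=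
    (Function.Embedding.refl _).sumMap .inl
  let B := hubStars c M (Sum.elim (fun k : Fin N => if (k : ℕ) < s then d + 1 else d)
    fun _ : (Fin R ⊕ Fin R) ⊕ Fin n => d)
  have hB : ¬ P.Forbids B := fun h => hall _ (h.mono (hubStars_sumElim_isContained ..))
  obtain ⟨p, q, hpq⟩ := ((Function.Embedding.refl (Fin c)).sumMap
    (m.prodMap (.refl (Fin (M + 1))))).exists_factor_through_fin (n := n)
    (by simp; nlinarith) (by simp; nlinarith)
  refine ⟨B.comap q, fun i => p (.inr (.inr (.inl i), 0)),
    fun j => p (.inr (.inr (.inr j), 0)), ?_, ?_, ?_, ?_, ?_⟩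
  · intro i j h
    simpa using p.injective h
  · intro i j h
    simpa using p.injective h
  · intro i j h
    simpa using p.injective h
  · exact hsub.holds_of_not_forbids hB hn ⟨⟨⟨q, fun h => h⟩, q.injective⟩⟩
  · intro i j
    refine (hforb.mono (hubStars_isContained_sup_edge c M d s N
      (Sum.inl_ne_inr (a := i) (b := j)))) n _ ?_
    refine ⟨⟨⟨p, fun {u v} huv => ?_⟩, p.injective⟩⟩
    rcases huv with huv | huv
    · left
      change B.Adj (q (p u)) (q (p v))
      rw [hpq, hpq]
      exact hubStars_le_comap_of_embedding m (by rintro (k | x) <;> simp [m]) huv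
    · right
      rw [SimpleGraph.edge_adj] at huv ⊢
      refine ⟨?_, p.injective.ne huv.2⟩
      rcases huv.1 with h | h <;> simp [h]

end GraphProperty

/-! ### From sensitivity to query complexity -/

namespace GraphProperty

variable {P : GraphProperty} {n R : ℕ}

theorem edgeBit_ne_sup_edge {V : Type} {A : SimpleGraph V} {w z : V} {p : V × V}
    (h : edgeBit A p ≠ edgeBit (A ⊔ SimpleGraph.edge w z) p) : p = (w, z) ∨ p = (z, w) := by
  obtain ⟨u, v⟩ := p
  by_contra hp
  refine h ?_
  simp only [Prod.mk.injEq] at hp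
  have he : ¬ (SimpleGraph.edge w z).Adj u v := by
    rw [SimpleGraph.edge_adj]
    rintro ⟨⟨rfl, rfl⟩ | ⟨rfl, rfl⟩, -⟩ <;> simp at hp
  simp [edgeBit, he]

/-- A sensitive property is at least as hard as searching for a marked item among `R ^ 2` ones. -/
theorem IsSensitive.exists_family (h : P.IsSensitive n R) :
    ∃ (A : SimpleGraph (Fin n)) (B : Fin R × Fin R → SimpleGraph (Fin n)),
      P.Holds n A ∧ (∀ k, ¬ P.Holds n (B k)) ∧
      ∀ p k l, edgeBit A p ≠ edgeBit (B k) p → edgeBit A p ≠ edgeBit (B l) p → k = l := by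
  obtain ⟨A, w, z, hw, hz, hwz, hA, hB⟩ := h
  refine ⟨A, fun k => A ⊔ SimpleGraph.edge (w k.1) (z k.2), hA, fun k => hB _ _, ?_⟩
  rintro p ⟨i, j⟩ ⟨i', j'⟩ hk hl
  rcases edgeBit_ne_sup_edge hk with rfl | rfl <;> rcases edgeBit_ne_sup_edge hl with h | h <;>
    rw [Prod.mk.injEq] at h
  · exact Prod.ext (hw h.1) (hz h.2)
  · exact (hwz _ _ h.1).elim
  · exact (hwz _ _ h.2).elim
  · exact Prod.ext (hw h.2) (hz h.1)

theorem IsSensitive.le_quantumQuery (h : P.IsSensitive n R) (hn : 0 < n) :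
    (R : ℝ) ≤ 12 * P.quantumQuery n := by
  obtain ⟨A, B, hA, hB, hAB⟩ := h.exists_family
  obtain ⟨Q, hQ⟩ := Nat.sInf_mem (⟨n ^ 2, P.exists_quantumAlgorithm n hn⟩ :
    {T | ∃ A : QuantumAlgorithm (Fin n × Fin n), P.QuantumDecides n A T}.Nonempty)
  have := Q.card_le_of_distinguishes (edgeBit A) (fun k => edgeBit (B k)) hAB
    (P.quantumQuery n) ((hQ A).1 hA) (fun k => (hQ (B k)).2 (hB k))
  rw [Fintype.card_prod, Fintype.card_fin, Nat.cast_mul] at this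
  refine (sq_le_sq₀ (by positivity) (by positivity)).1 ?_
  linarith

theorem exists_pmf (P : GraphProperty) (n : ℕ) : ∃ μ : PMF (DecisionTree (Fin n × Fin n)),
    (∀ t ∈ μ.support, t.depth ≤ P.detQuery n) ∧
    ∀ G : SimpleGraph (Fin n), (2 / 3 : ℝ≥0∞) ≤ μ.toOuterMeasure {t | P.CorrectOn G t} := by
  obtain ⟨t, ht, h⟩ := Nat.sInf_mem (⟨n ^ 2, P.exists_decisionTree n⟩ :
    {k | ∃ t : DecisionTree (Fin n × Fin n),
      t.depth ≤ k ∧ ∀ G : SimpleGraph (Fin n), P.CorrectOn G t}.Nonempty)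
  refine ⟨PMF.pure t, fun t' ht' => ?_, fun G => ?_⟩
  · obtain rfl : t' = t := by simpa using ht'
    exact ht
  · rw [PMF.toOuterMeasure_pure_apply, if_pos (show t ∈ {t | P.CorrectOn G t} from h G)]
    exact ENNReal.div_le_of_le_mul (by norm_num)

theorem randQuery_le_detQuery (P : GraphProperty) (n : ℕ) : P.randQuery n ≤ P.detQuery n :=
  Nat.sInf_le (P.exists_pmf n)

theorem detQuery_le (P : GraphProperty) (n : ℕ) : P.detQuery n ≤ n ^ 2 :=
  Nat.sInf_le (P.exists_decisionTree n)

theorem IsSensitive.sq_le_randQuery (h : P.IsSensitive n R) : R ^ 2 ≤ 3 * P.randQuery n := by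
  obtain ⟨A, B, hA, hB, hAB⟩ := h.exists_family
  obtain ⟨μ, hμ, hc⟩ := Nat.sInf_mem (⟨P.detQuery n, P.exists_pmf n⟩ :
    {k | ∃ μ : PMF (DecisionTree (Fin n × Fin n)), (∀ t ∈ μ.support, t.depth ≤ k) ∧
      ∀ G : SimpleGraph (Fin n),
        (2 / 3 : ℝ≥0∞) ≤ μ.toOuterMeasure {t | P.CorrectOn G t}}.Nonempty)
  have := PMF.card_le_of_distinguishes (edgeBit A) (fun k => edgeBit (B k)) hAB μ
    (P.randQuery n) hμ (by simpa [CorrectOn, hA] using hc A)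
    (fun k => by simpa [CorrectOn, hB k] using hc (B k))
  simpa [sq] using this

theorem exists_eventually_isSensitive (hP : P.Nontrivial) (hsub : P.SubgraphClosed) :
    ∃ C : ℕ, ∀ᶠ n in atTop, ∃ R, P.IsSensitive n R ∧ n ≤ C * R := by
  obtain ⟨a, b, hb, h⟩ := exists_isSensitive hP hsub
  refine ⟨a + 2 * b, ?_⟩
  filter_upwards [eventually_ge_atTop (a + b)] with n hn
  have h1 := Nat.mul_div_le (n - a) b
  have h2 := Nat.lt_mul_div_succ (n - a) hb
  have h3 : 1 ≤ (n - a) / b := (Nat.one_le_div_iff hb).2 (by omega)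
  -- Since `R ≥ 1`, the bound `n < a + b * (R + 1)` gives `n ≤ (a + 2 * b) * R`.
  refine ⟨(n - a) / b, h n _ (by omega) (by omega), ?_⟩
  have h4 : n < a + b * ((n - a) / b + 1) := by omega
  nlinarith

end GraphProperty

theorem mainTheorem9 (P : GraphProperty) (hP : P.Nontrivial) (hsub : P.SubgraphClosed) :
    ((fun n : ℕ => (n : ℝ)) =O[atTop] fun n : ℕ => (P.quantumQuery n : ℝ)) ∧
    ((fun n : ℕ => (P.randQuery n : ℝ)) =Θ[atTop] fun n : ℕ => (n : ℝ) ^ 2) ∧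
    ((fun n : ℕ => (P.detQuery n : ℝ)) =Θ[atTop] fun n : ℕ => (n : ℝ) ^ 2) := by
  obtain ⟨C, hC⟩ := GraphProperty.exists_eventually_isSensitive hP hsub
  have hdet : (fun n : ℕ => (P.detQuery n : ℝ)) =O[atTop] fun n : ℕ => (n : ℝ) ^ 2 :=
    IsBigO.of_bound' (.of_forall fun n => by
      simpa using (by exact_mod_cast P.detQuery_le n : (P.detQuery n : ℝ) ≤ (n : ℝ) ^ 2))
  have hrd : (fun n : ℕ => (P.randQuery n : ℝ)) =O[atTop] fun n : ℕ => (P.detQuery n : ℝ) :=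
    IsBigO.of_bound' (.of_forall fun n => by simpa using P.randQuery_le_detQuery n)
  have hrand : (fun n : ℕ => (n : ℝ) ^ 2) =O[atTop] fun n : ℕ => (P.randQuery n : ℝ) := by
    refine IsBigO.of_bound (3 * (C : ℝ) ^ 2) ?_
    filter_upwards [hC] with n hn
    obtain ⟨R, hR, hnR⟩ := hn
    have h1 : (n : ℝ) ^ 2 ≤ (C * R) ^ 2 := by gcongr; exact_mod_cast hnR
    have h2 : (R : ℝ) ^ 2 ≤ 3 * P.randQuery n := by exact_mod_cast hR.sq_le_randQuery
    rw [Real.norm_of_nonneg (by positivity), Real.norm_of_nonneg (by positivity)]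
    calc (n : ℝ) ^ 2 ≤ (C : ℝ) ^ 2 * (R : ℝ) ^ 2 := by rwa [mul_pow] at h1
      _ ≤ (C : ℝ) ^ 2 * (3 * P.randQuery n) := by gcongr
      _ = _ := by ring
  refine ⟨?_, ⟨hrd.trans hdet, hrand⟩, hdet, hrand.trans hrd⟩
  refine IsBigO.of_bound (12 * (C : ℝ)) ?_
  filter_upwards [hC, eventually_gt_atTop 0] with n hn hpos
  obtain ⟨R, hR, hnR⟩ := hn
  have h1 : (n : ℝ) ≤ C * R := by exact_mod_cast hnR
  rw [Real.norm_of_nonneg (by positivity), Real.norm_of_nonneg (by positivity)]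
  calc (n : ℝ) ≤ C * R := h1
    _ ≤ C * (12 * P.quantumQuery n) := by gcongr; exact hR.le_quantumQuery hpos
    _ = _ := by ring
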